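/- **Notation.** $\mathcal P_2(\mathbb R^d)$ is the set of Borel probability measures on $\mathbb R^d$ with finite second moment, and $W_p(\mu,\nu)=\bigl(\inf_\pi\iint|x-y|^p\,d\pi\bigr)^{1/p}$ ($p=1,2$), the infimum being over all couplings $\pi$ of $\mu$ and $\nu$; $\mathbf W_2=(\mathcal P_2(\mathbb R^d),W_2)$. For $\phi:\mathcal P_2(\mathbb R^d)\to\mathbb R$, a *first variation* is a function $\frac{\delta\phi}{\delta\mu}:\mathcal P_2(\mathbb R^d)\times\mathbb R^d\to\mathbb R$ that is jointly continuous on $\mathbf W_2\times\mathbb R^d$, has at most quadratic growth in $x$ for each measure, and satisfies, for all $\rho,\rho'\in\mathcal P_2(\mathbb R^d)$, $$\lim_{\varepsilon\downarrow0}\frac{\phi((1-\varepsilon)\rho+\varepsilon\rho')-\phi(\rho)}{\varepsilon}=\int\frac{\delta\phi}{\delta\mu}(\rho,x)\,d(\rho'-\rho)(x);$$ it is unique up to an additive constant depending on $\rho$ and is normalized by $\int\frac{\delta\phi}{\delta\mu}(\rho,y)\,d\rho(y)=0$. We write $\phi\in C^1(\mathbf W_2)$ if a first variation exists, is differentiable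 in $x$, and $\nabla_{\mathbf W}\phi(\rho,x):=\nabla_x\frac{\delta\phi}{\delta\mu}(\rho,x)$ is jointly continuous on $\mathbf W_2\times\mathbb R^d$ with at most quadratic growth in $x$ for each $\rho$. We write $\phi\in C^2(\mathbf W_2)$ if $\phi\in C^1(\mathbf W_2)$, each component of $\rho\mapsto\nabla_{\mathbf W}\phi(\rho,x)$ is in $C^1(\mathbf W_2)$ for every $x$, and the Wasserstein Hessian $\nabla^2_{\mathbf W}\phi(\rho,x,y)\in\mathbb R^{d\times d}$, whose $i$-th row is the Wasserstein gradient at $(\rho,y)$ of $\mu\mapsto(\nabla_{\mathbf W}\phi(\mu,x))_i$, is jointly continuous on $\mathbf W_2\times\mathbb R^d\times\mathbb R^d$. For $\rho_0\in\mathcal P_2(\mathbb R^d)$ let $\mathbb H=L^2(\mathbb R^d,\rho_0;\mathbb R^d)$ and let $\phi^{\#}_{\rho_0}(\xi)=\phi(\xi_\#\rho_0)$, $\xi\in\mathbb H$, be the lift of $\phi$. The lift is of class $C^{1,1}(\mathbb H;\mathbb H)$ if it is Fréchet differentiable with Lipschitz gradient. A curve $u:[0,\infty)\to\mathbb H$ is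 in $C^{1,\alpha}([0,\infty);\mathbb H)$ if it is differentiable (one-sidedly at $0$) and there is a constant $K$ with $\|u(t+h)-u(t)-h\dot u(t)\|_{\mathbb H}\le K|h|^{1+\alpha}$ for all $t,t+h\ge0$. **Theorem 4.5.** Let $\rho_0\in\mathcal P_2(\mathbb R^d)$ have no atoms and let $\phi\in C^2(\mathbf W_2)$ be such that $\phi^{\#}_{\rho_0}\in C^{1,1}(\mathbb H;\mathbb H)$ and such that, on every bounded subset of $\mathbf W_2$, uniformly in the measure, $\nabla_{\mathbf W}\phi(\rho,\cdot)$ has at most linear growth and $\frac{\delta\phi}{\delta\mu}(\rho,\cdot)$ at most quadratic growth. Assume that $\nabla_{\mathbf W}\phi(\rho,\cdot)$ is differentiable for every $\rho$, and that there are $\alpha\in(0,1]$ and $C\ge0$ such that for all $\rho,\mu,\nu\in\mathcal P_2(\mathbb R^d)$ and $x,y\in\mathbb R^d$ $$|\nabla_{\mathbf W}\phi(\rho,x)|+|\nabla_x\nabla_{\mathbf W}\phi(\rho,x)|+|\nabla^2_{\mathbf W}\phi(\rho,x,y)|\le C,$$ $$[\nabla_x\nabla_{\mathbf W}\phi(\rho,\cdot)]_{C^\alpha(\mathbb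 R^d)}\le C,\qquad[\nabla^2_{\mathbf W}\phi(\rho,\cdot,\cdot)]_{C^\alpha(\mathbb R^d\times\mathbb R^d)}\le C,$$ $$|\nabla^2_{\mathbf W}\phi(\mu,x,y)-\nabla^2_{\mathbf W}\phi(\nu,x,y)|\le C\,W_1(\mu,\nu)^\alpha .$$ Then the Lagrangian flow $$\dot X(t)=-\nabla\phi^{\#}_{\rho_0}(X(t))\ \text{ in }\mathbb H\text{ for } t\ge0,\qquad X(0)=\mathrm{Id},$$ has a unique solution $X:[0,\infty)\to\mathbb H$, its velocity satisfies $\dot X\in C^{1,\alpha}([0,\infty);\mathbb H)$, and for every $t\ge0$ and $\rho_0$-a.e. $x$ the integrand below is $\rho_0$-integrable in $z$ and $$\ddot X(t,x)=-\Bigl(\nabla_x\nabla_{\mathbf W}\phi\bigl(X(t)_\#\rho_0,X(t,x)\bigr)\dot X(t,x)+\int_{\mathbb R^d}\nabla^2_{\mathbf W}\phi\bigl(X(t)_\#\rho_0,X(t,x),X(t,z)\bigr)\dot X(t,z)\,d\rho_0(z)\Bigr).$$ -/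

import Mathlib

open MeasureTheory Set Filter Topology
open scoped ENNReal NNReal

noncomputable section

/-- Euclidean space `ℝ^d`. -/
abbrev E (d : ℕ) : Type := EuclideanSpace ℝ (Fin d)

/-- Borel probability measures on `ℝ^d` with finite second moment. -/
structure P2 (d : ℕ) where
  toMeasure : Measure (E d)
  isProb : IsProbabilityMeasure toMeasure
  memLp : MemLp (fun x : E d => x) 2 toMeasure

namespace P2

variable {d : ℕ}

instance (ρ : P2 d) : IsProbabilityMeasure ρ.toMeasure := ρ.isProb

/-- The Hilbert space `L²(ℝ^d; ρ)` of `ℝ^d`-valued maps. -/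
abbrev L2 (ρ : P2 d) : Type := Lp (E d) 2 ρ.toMeasure

/-- The identity map as an element of `L²(ℝ^d; ρ)`. -/
def idL2 (ρ : P2 d) : ρ.L2 := ρ.memLp.toLp (fun x : E d => x)

/-- The push-forward `ξ_# ρ` for `ξ ∈ L²(ℝ^d; ρ)`. -/
def push (ρ : P2 d) (ξ : ρ.L2) : P2 d where
  toMeasure := ρ.toMeasure.map ξ
  isProb := Measure.isProbabilityMeasure_map (Lp.aestronglyMeasurable ξ).aemeasurable
  memLp := (memLp_map_measure_iff aestronglyMeasurable_id
    (Lp.aestronglyMeasurable ξ).aemeasurable).2 (Lp.memLp ξ)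

/-- The mixture `(1 - ε) ρ + ε ρ'`, for `ε ∈ [0,1]`. -/
def mix (ρ ρ' : P2 d) (ε : unitInterval) : P2 d where
  toMeasure := ENNReal.ofReal (1 - (ε : ℝ)) • ρ.toMeasure
    + ENNReal.ofReal (ε : ℝ) • ρ'.toMeasure
  isProb := ⟨by
    simp only [Measure.coe_add, Measure.coe_smul, Pi.add_apply, Pi.smul_apply, measure_univ,
      smul_eq_mul, mul_one]
    rw [← ENNReal.ofReal_add (by linarith [ε.2.2]) ε.2.1]
    simp⟩
  memLp := by
    refine (memLp_two_iff_integrable_sq_norm aestronglyMeasurable_id).2 ?_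
    exact (((memLp_two_iff_integrable_sq_norm aestronglyMeasurable_id).1 ρ.memLp).smul_measure
      ENNReal.ofReal_ne_top).add_measure
      (((memLp_two_iff_integrable_sq_norm aestronglyMeasurable_id).1 ρ'.memLp).smul_measure
      ENNReal.ofReal_ne_top)

/-- The Dirac mass at `x`. -/
def dirac (x : E d) : P2 d where
  toMeasure := Measure.dirac x
  isProb := inferInstance
  memLp := by
    refine (memLp_congr_ae ?_).1 (memLp_const x)
    exact (ae_eq_dirac (fun y : E d => y)).symm

/-- The Wasserstein distance of exponent `p`, with values in `[0,∞]`: the `p`-th root of the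
infimum of `∬ |x - y|^p dπ` over all couplings `π` of `μ` and `ν`. -/
def wassersteinE (p : ℝ) (μ ν : P2 d) : ℝ≥0∞ :=
  (⨅ π ∈ {π : Measure (E d × E d) |
      π.map Prod.fst = μ.toMeasure ∧ π.map Prod.snd = ν.toMeasure},
    ∫⁻ z, edist z.1 z.2 ^ p ∂π) ^ (1 / p)

/-- The Wasserstein distance of exponent `p`, used for `p = 1` and `p = 2`; it is finite there
since both measures have finite second moment. -/
def W (p : ℝ) (μ ν : P2 d) : ℝ := (wassersteinE p μ ν).toReal

end P2

section Calculus

variable {d : ℕ}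

/-- Joint continuity on `W₂(ℝ^d) × A`, for a metric space `A`. -/
def JointlyContinuous {A B : Type*} [PseudoMetricSpace A] [PseudoMetricSpace B]
    (f : P2 d → A → B) : Prop :=
  ∀ (ρ : P2 d) (a : A), ∀ ε > 0, ∃ δ > 0, ∀ (ρ' : P2 d) (a' : A),
    P2.W 2 ρ ρ' < δ → dist a a' < δ → dist (f ρ a) (f ρ' a') < ε

/-- At most quadratic growth. -/
def QuadraticGrowth {B : Type*} [Norm B] (f : E d → B) : Prop :=
  ∃ C : ℝ, ∀ x, ‖f x‖ ≤ C * (1 + ‖x‖ ^ 2)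

/-- `F` is a first variation of `φ`; it is determined by `φ` up to a constant depending on `ρ`. -/
structure IsFirstVariation (φ : P2 d → ℝ) (F : P2 d → E d → ℝ) : Prop where
  cont : JointlyContinuous F
  growth : ∀ ρ, QuadraticGrowth (F ρ)
  limit : ∀ ρ ρ' : P2 d,
    Tendsto (fun ε : unitInterval => (φ (ρ.mix ρ' ε) - φ ρ) / (ε : ℝ)) (𝓝[>] 0)
      (𝓝 ((∫ x, F ρ x ∂ρ'.toMeasure) - ∫ x, F ρ x ∂ρ.toMeasure))

/-- `φ ∈ C¹(𝒫₂(ℝ^d); ℝ)`. -/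
def IsC1P2 (φ : P2 d → ℝ) : Prop := ∃ F, IsFirstVariation φ F

open Classical in
/-- The first variation `δφ/δμ (ρ, x)`, normalized by `∫ δφ/δμ (ρ, y) dρ(y) = 0`. -/
def firstVariation (φ : P2 d → ℝ) (ρ : P2 d) (x : E d) : ℝ :=
  if h : IsC1P2 φ then h.choose ρ x - ∫ y, h.choose ρ y ∂ρ.toMeasure else 0

/-- The normalized first variation does not depend on the choice of a first variation. -/
theorem firstVariation_eq {φ : P2 d → ℝ} {F : P2 d → E d → ℝ} (hF : IsFirstVariation φ F)
    (ρ : P2 d) (x : E d) :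
    firstVariation φ ρ x = F ρ x - ∫ y, F ρ y ∂ρ.toMeasure := by
  have h : IsC1P2 φ := ⟨F, hF⟩
  have hne : (𝓝[>] (0 : unitInterval)).NeBot :=
    nhdsGT_neBot_of_exists_gt ⟨1, zero_lt_one⟩
  have h1 := h.choose_spec.limit ρ (P2.dirac x)
  have h2 := hF.limit ρ (P2.dirac x)
  have h3 := tendsto_nhds_unique h1 h2
  simp only [P2.dirac, integral_dirac] at h3
  simp only [firstVariation, dif_pos h]
  exact h3

/-- The Wasserstein gradient `∇_W φ(ρ, x) = ∇_x (δφ/δμ)(ρ, x)`. -/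
def wGrad (φ : P2 d → ℝ) (ρ : P2 d) (x : E d) : E d := gradient (firstVariation φ ρ) x

/-- `φ ∈ C¹(W₂(ℝ^d); ℝ)`. -/
structure IsC1W (φ : P2 d → ℝ) : Prop where
  isC1P2 : IsC1P2 φ
  diff : ∀ ρ, Differentiable ℝ (firstVariation φ ρ)
  cont : JointlyContinuous (wGrad φ)
  growth : ∀ ρ, QuadraticGrowth (wGrad φ ρ)

/-- The Wasserstein Hessian `∇²_W φ(ρ, x, y)`, a linear map on `ℝ^d`. The `i`-th row of its matrix
is the Wasserstein gradient at `(ρ, y)` of the functional `μ ↦ (∇_W φ(μ, x))ᵢ`. -/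
def wHess (φ : P2 d → ℝ) (ρ : P2 d) (x y : E d) : E d →L[ℝ] E d :=
  ((EuclideanSpace.equiv (Fin d) ℝ).symm : (Fin d → ℝ) →L[ℝ] E d).comp
    (ContinuousLinearMap.pi fun i => innerSL ℝ (wGrad (fun μ => wGrad φ μ x i) ρ y))

/-- `φ ∈ C²(W₂(ℝ^d); ℝ)`. -/
structure IsC2W (φ : P2 d → ℝ) : Prop where
  isC1W : IsC1W φ
  grad_isC1W : ∀ (x : E d) (i : Fin d), IsC1W fun μ => wGrad φ μ x i
  cont : JointlyContinuous fun (ρ : P2 d) (p : E d × E d) => wHess φ ρ p.1 p.2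

/-- Linear growth of `∇_W φ(ρ, ·)` and quadratic growth of `δφ/δμ (ρ, ·)`, both uniform for `ρ` in
bounded subsets of `W₂(ℝ^d)`. -/
def LocallyUniformGrowth (φ : P2 d → ℝ) : Prop :=
  ∀ K : Set (P2 d), (∃ R : ℝ, ∀ μ ∈ K, ∀ ν ∈ K, P2.W 2 μ ν ≤ R) →
    (∃ C : ℝ, ∀ ρ ∈ K, ∀ x, ‖wGrad φ ρ x‖ ≤ C * (1 + ‖x‖)) ∧
    (∃ C : ℝ, ∀ ρ ∈ K, ∀ x, |firstVariation φ ρ x| ≤ C * (1 + ‖x‖ ^ 2))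

/-- The lift `ξ ↦ φ(ξ_# ρ₀)` on `L²(ℝ^d; ρ₀)`. -/
def liftL2 (φ : P2 d → ℝ) (ρ₀ : P2 d) (ξ : ρ₀.L2) : ℝ := φ (ρ₀.push ξ)

/-- The class `C^{1,α}(H; H)` of functionals on a Hilbert space `H`: Fréchet differentiable with
`α`-Hölder gradient. -/
def IsC1HolderFunctional {H : Type*} [NormedAddCommGroup H] [InnerProductSpace ℝ H]
    [CompleteSpace H] (α : ℝ≥0) (u : H → ℝ) : Prop :=
  Differentiable ℝ u ∧ ∃ C : ℝ≥0, HolderWith C α (gradient u)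

/-- The time derivative of a curve on `[0,∞)` (one-sided at `0`). -/
def timeDeriv {H : Type*} [NormedAddCommGroup H] [NormedSpace ℝ H] (u : ℝ → H) : ℝ → H :=
  derivWithin u (Ici 0)

/-- The class `C^{1,α}([0,∞); H)` of curves, with one constant for the whole half-line. -/
def IsC1HolderCurve {H : Type*} [NormedAddCommGroup H] [NormedSpace ℝ H] (α : ℝ≥0)
    (u : ℝ → H) : Prop :=
  DifferentiableOn ℝ u (Ici 0) ∧
  ∃ C : ℝ, ∀ t h : ℝ, 0 ≤ t → 0 ≤ t + h →
    ‖u (t + h) - u t - h • timeDeriv u t‖ ≤ C * |h| ^ (1 + (α : ℝ))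

/-- `X` solves `Ẋ(t) = -∇φ^#(X(t))` on `[0,∞)`, `X(0) = Id`, in `L²(ℝ^d; ρ₀)`. Only the values of
`X` on `[0,∞)` matter. -/
def IsLagrangianFlow (φ : P2 d → ℝ) (ρ₀ : P2 d) (X : ℝ → ρ₀.L2) : Prop :=
  X 0 = ρ₀.idL2 ∧
  ∀ t : ℝ, 0 ≤ t → HasDerivWithinAt X (-gradient (liftL2 φ ρ₀) (X t)) (Ici 0) t

end Calculus

end

/-!
The lift `ξ ↦ φ(ξ_# ρ₀)` has a bounded Lipschitz gradient, so the flow exists globally and is unique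
by Picard–Lindelöf. What has to be understood is its velocity as a function of the particle `x`.

The link between the lift and the calculus on measures is a mean value theorem. On the segment of
measures from `μ` to `ν` the functional is differentiable in the mixing parameter, because its first
variation gives the one-sided derivatives towards both ends; Lagrange's theorem and then the mean
value theorem in space express `φ(η_# ρ) - φ(ξ_# ρ)` as the integral of `⟪∇_W φ(m, c), η - ξ⟫` with
an intermediate measure `m` and intermediate points `c` (`IsC1W.exists_push_mean_value`). An explicit
coupling bounds the distance from `m` to `ξ_# ρ` by that of `η` to `ξ`.

Applied to `φ`, this identifies the gradient of the lift at `ξ` with `∇_W φ(ξ_# ρ, ξ(·))`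
(`IsC1W.gradient_liftL2_ae_eq`), so the velocity is `V = -∇_W φ(X_# ρ₀, X)`. Applied to the components
of `∇_W φ(·, y)`, it gives the first order expansion of `V` in the measure, with a Hölder error; the
expansion in the point is Taylor's formula. Together they show that the lifted gradient has derivative
`hessAction` along essentially bounded displacements
(`HasHolderHessian.norm_wGrad_push_comp_sub_sub_hessAction_le`).

Bounds in `L²` would not suffice here, since an error of order `|X(t+h) - X(t)|^(1+α)` is not controlled
in `L²` by the `L²` norm of the displacement. But the velocity is bounded by `C` for almost every
particle, and so is every difference quotient of `X`, by convexity and closedness in `L²` of the set of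
such maps (`ae_norm_sub_le_of_hasDerivAt`). Hence `X(t+h) - X(t) = h V(t) + O(h²)` essentially
uniformly, and inserting this in the expansion yields the acceleration and the `C^{1,α}` bound
(`HasHolderHessian.exists_acceleration`).
-/

/-! ### Global integral curves and curves in `L²` -/

/-- A bounded Lipschitz vector field on a Banach space is complete. The Picard–Lindelöf interval
`[-n, n]` is available for every `n` because the a priori bound confines the curve to a ball of
radius `L * n`; the local solutions are glued by uniqueness. -/
theorem exists_integralCurve_of_lipschitzWith_of_norm_le {H : Type*} [NormedAddCommGroup H]
    [NormedSpace ℝ H] [CompleteSpace H] {f : H → H} {K L : ℝ≥0} (hK : LipschitzWith K f)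
    (hL : ∀ x, ‖f x‖ ≤ L) (x₀ : H) :
    ∃ X : ℝ → H, X 0 = x₀ ∧ ∀ t, HasDerivAt X (f (X t)) t := by
  have key : ∀ n : ℕ, ∃ α : ℝ → H, α 0 = x₀ ∧
      ∀ t ∈ Ioo (-((n : ℝ) + 1)) ((n : ℝ) + 1), HasDerivAt α (f (α t)) t := by
    intro n
    have h0 : (0 : ℝ) ∈ Icc (-((n : ℝ) + 1)) ((n : ℝ) + 1) := by
      constructor <;> linarith [n.cast_nonneg (α := ℝ)]
    have hPL : IsPicardLindelof (fun _ => f) (⟨0, h0⟩ : Icc (-((n : ℝ) + 1)) ((n : ℝ) + 1))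
        x₀ (L * (n + 1)) 0 L K :=
      IsPicardLindelof.of_time_independent (fun x _ => hL x) hK.lipschitzOnWith
        (le_of_eq (by simp))
    obtain ⟨α, hα0, hα⟩ := hPL.exists_eq_forall_mem_Icc_hasDerivWithinAt₀
    exact ⟨α, hα0, fun t ht =>
      (hα t (Ioo_subset_Icc_self ht)).hasDerivAt (Icc_mem_nhds ht.1 ht.2)⟩
  choose α hα0 hα using key
  have agree : ∀ m n : ℕ, m ≤ n → EqOn (α m) (α n) (Ioo (-((m : ℝ) + 1)) ((m : ℝ) + 1)) := by
    intro m n hmn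
    have hmn' : (m : ℝ) ≤ n := by exact_mod_cast hmn
    refine ODE_solution_unique_of_mem_Ioo (v := fun _ => f) (s := fun _ => univ) (K := K)
      (t₀ := 0) (fun t _ => hK.lipschitzOnWith) ?_ (fun t ht => ⟨hα m t ht, mem_univ _⟩)
      (fun t ht => ⟨hα n t ⟨by linarith [ht.1], by linarith [ht.2]⟩, mem_univ _⟩)
      (by rw [hα0, hα0])
    constructor <;> linarith [m.cast_nonneg (α := ℝ)]
  have hX : ∀ (n : ℕ) (t : ℝ), t ∈ Ioo (-((n : ℝ) + 1)) ((n : ℝ) + 1) →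
      α ⌈|t|⌉₊ t = α n t := by
    intro n t ht
    have h1 : t ∈ Ioo (-((⌈|t|⌉₊ : ℝ) + 1)) ((⌈|t|⌉₊ : ℝ) + 1) := by
      have := Nat.le_ceil |t|
      constructor <;> linarith [neg_abs_le t, le_abs_self t]
    rcases le_total ⌈|t|⌉₊ n with h | h
    · exact agree _ _ h h1
    · exact (agree _ _ h ht).symm
  refine ⟨fun t => α ⌈|t|⌉₊ t, by simp [hα0], fun t => ?_⟩
  have ht : t ∈ Ioo (-((⌈|t|⌉₊ : ℝ) + 1)) ((⌈|t|⌉₊ : ℝ) + 1) := by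
    have := Nat.le_ceil |t|
    constructor <;> linarith [neg_abs_le t, le_abs_self t]
  refine (hα _ t ht).congr_of_eventuallyEq ?_
  filter_upwards [Ioo_mem_nhds ht.1 ht.2] with s hs
  exact hX _ s hs

/-- Mean value theorem in a closed convex set: difference quotients of a `C¹` curve are averages of
its velocity. -/
theorem inv_smul_sub_mem_of_hasDerivAt {H : Type*} [NormedAddCommGroup H] [NormedSpace ℝ H]
    [CompleteSpace H] {s : Set H} (hs : Convex ℝ s) (hsc : IsClosed s) {X V : ℝ → H}
    (hX : ∀ t, HasDerivAt X (V t) t) (hV : Continuous V) {a b : ℝ} (hab : a ≠ b)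
    (hmem : ∀ t ∈ uIcc a b, V t ∈ s) : (b - a)⁻¹ • (X b - X a) ∈ s := by
  have hint : IntervalIntegrable V volume a b := hV.intervalIntegrable a b
  rw [← intervalIntegral.integral_eq_sub_of_hasDerivAt (fun t _ => hX t) hint,
    ← interval_average_eq]
  refine hs.set_average_mem hsc ?_ ?_ ?_ (intervalIntegrable_iff.1 hint)
  · rw [uIoc, Real.volume_Ioc]
    simpa using fun h : b ≤ a => h.lt_of_ne hab.symm
  · rw [uIoc, Real.volume_Ioc]
    exact ENNReal.ofReal_ne_top
  · exact (ae_restrict_iff' measurableSet_uIoc).2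
      (Eventually.of_forall fun t ht => hmem t (uIoc_subset_uIcc ht))

section AEBound

variable {Ω F : Type*} [MeasurableSpace Ω] {μ : Measure Ω} [NormedAddCommGroup F]

theorem convex_setOf_ae_norm_le [NormedSpace ℝ F] (M : ℝ) :
    Convex ℝ {f : Lp F 2 μ | ∀ᵐ x ∂μ, ‖f x‖ ≤ M} := by
  intro f hf g hg a b ha hb hab
  filter_upwards [hf, hg, Lp.coeFn_add (a • f) (b • g), Lp.coeFn_smul a f,
    Lp.coeFn_smul b g] with x h1 h2 h3 h4 h5
  rw [h3, Pi.add_apply, h4, h5]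
  calc ‖a • f x + b • g x‖ ≤ ‖a • f x‖ + ‖b • g x‖ := norm_add_le _ _
    _ = a * ‖f x‖ + b * ‖g x‖ := by
      rw [norm_smul, norm_smul, Real.norm_of_nonneg ha, Real.norm_of_nonneg hb]
    _ ≤ a * M + b * M := by gcongr
    _ = M := by rw [← add_mul, hab, one_mul]

theorem isClosed_setOf_ae_norm_le (M : ℝ) :
    IsClosed {f : Lp F 2 μ | ∀ᵐ x ∂μ, ‖f x‖ ≤ M} := by
  refine IsSeqClosed.isClosed fun u f hu huf => ?_
  obtain ⟨ns, -, hns⟩ := (tendstoInMeasure_of_tendsto_Lp huf).exists_seq_tendsto_ae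
  filter_upwards [hns, ae_all_iff.2 hu] with x hx hb
  exact le_of_tendsto hx.norm (Eventually.of_forall fun i => hb (ns i))

/-- Pointwise mean value inequality for a `C¹` curve in `L²`: an essential bound on the velocity
bounds the increments essentially, since the essential ball is closed and convex in `L²`. -/
theorem ae_norm_sub_le_of_hasDerivAt [NormedSpace ℝ F] [CompleteSpace F] {X V : ℝ → Lp F 2 μ}
    (hX : ∀ t, HasDerivAt X (V t) t) (hV : Continuous V) {a b M : ℝ}
    (hM : ∀ s ∈ uIcc a b, ∀ᵐ x ∂μ, ‖V s x‖ ≤ M) :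
    ∀ᵐ x ∂μ, ‖X b x - X a x‖ ≤ M * |b - a| := by
  rcases eq_or_ne a b with rfl | hab
  · simp
  have hmem := inv_smul_sub_mem_of_hasDerivAt (convex_setOf_ae_norm_le (μ := μ) (F := F) M)
    (isClosed_setOf_ae_norm_le M) hX hV hab hM
  filter_upwards [hmem, Lp.coeFn_smul (b - a)⁻¹ (X b - X a), Lp.coeFn_sub (X b) (X a)]
    with x h1 h2 h3
  rw [h2, Pi.smul_apply, h3, Pi.sub_apply, norm_smul, norm_inv, Real.norm_eq_abs] at h1
  have hpos : 0 < |b - a| := abs_pos.2 (sub_ne_zero.2 hab.symm)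
  rwa [inv_mul_le_iff₀ hpos, mul_comm] at h1

end AEBound

/-- A curve with a first order expansion of order `1 + α` at `t` is differentiable at `t`. -/
theorem hasDerivAt_of_norm_sub_le_rpow {H : Type*} [NormedAddCommGroup H] [NormedSpace ℝ H]
    {V : ℝ → H} {A : H} {t K α : ℝ} (hα : 0 < α)
    (h : ∀ h : ℝ, ‖V (t + h) - V t - h • A‖ ≤ K * |h| ^ (1 + α)) : HasDerivAt V A t := by
  rw [hasDerivAt_iff_tendsto]
  have hlim : Tendsto (fun s : ℝ => K * |s - t| ^ α) (𝓝 t) (𝓝 0) := by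
    have : Continuous fun s : ℝ => K * |s - t| ^ α :=
      continuous_const.mul ((continuous_abs.comp (continuous_id.sub continuous_const)).rpow_const
        fun _ => Or.inr hα.le)
    simpa [Real.zero_rpow hα.ne'] using this.tendsto t
  refine squeeze_zero (fun s => by positivity) (fun s => ?_) hlim
  rcases eq_or_ne s t with rfl | hs
  · simp [Real.zero_rpow hα.ne']
  have hpos : 0 < |s - t| := abs_pos.2 (sub_ne_zero.2 hs)
  rw [Real.norm_eq_abs, inv_mul_le_iff₀ hpos]
  have := h (s - t)
  rw [add_sub_cancel, Real.rpow_add hpos, Real.rpow_one] at this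
  linarith

/-! ### Mixtures and couplings -/

namespace P2

variable {d : ℕ}

theorem ext_of_toMeasure {μ ν : P2 d} (h : μ.toMeasure = ν.toMeasure) : μ = ν := by
  cases μ; cases ν; simpa using h

theorem mix_mix_right (μ ν : P2 d) {τ ε σ : unitInterval}
    (h : 1 - (σ : ℝ) = (1 - ε) * (1 - τ)) : (μ.mix ν τ).mix ν ε = μ.mix ν σ := by
  apply ext_of_toMeasure
  have hσ : (σ : ℝ) = (1 - ε) * τ + ε := by linarith
  simp only [mix]
  rw [smul_add, smul_smul, smul_smul, ← ENNReal.ofReal_mul (sub_nonneg.2 ε.2.2),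
    ← ENNReal.ofReal_mul (sub_nonneg.2 ε.2.2), add_assoc, ← add_smul,
    ← ENNReal.ofReal_add (mul_nonneg (sub_nonneg.2 ε.2.2) τ.2.1) ε.2.1, h, hσ]

theorem mix_mix_left (μ ν : P2 d) {τ ε σ : unitInterval}
    (h : (σ : ℝ) = (1 - ε) * τ) : (μ.mix ν τ).mix μ ε = μ.mix ν σ := by
  apply ext_of_toMeasure
  have hσ : 1 - (σ : ℝ) = (1 - ε) * (1 - τ) + ε := by linarith
  simp only [mix]
  rw [smul_add, smul_smul, smul_smul, ← ENNReal.ofReal_mul (sub_nonneg.2 ε.2.2),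
    ← ENNReal.ofReal_mul (sub_nonneg.2 ε.2.2), add_right_comm, ← add_smul,
    ← ENNReal.ofReal_add (mul_nonneg (sub_nonneg.2 ε.2.2) (sub_nonneg.2 τ.2.2)) ε.2.1, hσ, h]

theorem mix_comm (μ ν : P2 d) {τ σ : unitInterval} (h : (τ : ℝ) = 1 - σ) :
    μ.mix ν τ = ν.mix μ σ := by
  apply ext_of_toMeasure
  simp only [mix]
  rw [h, sub_sub_cancel, add_comm]

theorem mix_zero (μ ν : P2 d) : μ.mix ν 0 = μ := by
  apply ext_of_toMeasure; simp [mix]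

theorem mix_one (μ ν : P2 d) : μ.mix ν 1 = ν := by
  apply ext_of_toMeasure; simp [mix]

theorem integral_mix (μ ν : P2 d) (τ : unitInterval) {f : E d → ℝ}
    (hμ : Integrable f μ.toMeasure) (hν : Integrable f ν.toMeasure) :
    ∫ x, f x ∂(μ.mix ν τ).toMeasure
      = (1 - τ) * ∫ x, f x ∂μ.toMeasure + τ * ∫ x, f x ∂ν.toMeasure := by
  simp only [mix]
  rw [integral_add_measure (hμ.smul_measure ENNReal.ofReal_ne_top)
    (hν.smul_measure ENNReal.ofReal_ne_top), integral_smul_measure, integral_smul_measure,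
    ENNReal.toReal_ofReal (sub_nonneg.2 τ.2.2), ENNReal.toReal_ofReal τ.2.1, smul_eq_mul,
    smul_eq_mul]

theorem integrable_of_quadraticGrowth (μ : P2 d) {f : E d → ℝ} (hf : Continuous f)
    (hg : QuadraticGrowth f) : Integrable f μ.toMeasure := by
  obtain ⟨C, hC⟩ := hg
  refine Integrable.mono' (g := fun x => C * (1 + ‖x‖ ^ 2)) ?_ hf.aestronglyMeasurable
    (Eventually.of_forall hC)
  exact ((integrable_const _).add
    ((memLp_two_iff_integrable_sq_norm aestronglyMeasurable_id).1 μ.memLp)).const_mul C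

/-- The distance from `ξ_# ρ` to a mixture of `ξ_# ρ` and `η_# ρ` is controlled by that of `ξ` and
`η`: keep the share `1 - τ` of the mass in place and move the share `τ` from `ξ` to `η`. -/
theorem wassersteinE_push_mix_le (ρ : P2 d) (ξ η : ρ.L2) (τ : unitInterval) {p : ℝ} (hp : 0 < p) :
    wassersteinE p (ρ.push ξ) ((ρ.push ξ).mix (ρ.push η) τ)
      ≤ (∫⁻ x, edist (ξ x) (η x) ^ p ∂ρ.toMeasure) ^ (1 / p) := by
  have hξ : AEMeasurable ξ ρ.toMeasure := (Lp.aestronglyMeasurable ξ).aemeasurable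
  have hη : AEMeasurable η ρ.toMeasure := (Lp.aestronglyMeasurable η).aemeasurable
  have hmeas : Measurable fun z : E d × E d => edist z.1 z.2 ^ p :=
    measurable_edist.pow_const p
  set a := ENNReal.ofReal (1 - (τ : ℝ))
  set b := ENNReal.ofReal (τ : ℝ)
  have hab : a + b = 1 := by
    rw [← ENNReal.ofReal_add (sub_nonneg.2 τ.2.2) τ.2.1]; simp
  refine ENNReal.rpow_le_rpow ?_ (by positivity)
  refine (iInf₂_le (a • ρ.toMeasure.map (fun x => (ξ x, ξ x))
    + b • ρ.toMeasure.map (fun x => (ξ x, η x))) ⟨?_, ?_⟩).trans ?_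
  · rw [lintegral_add_measure, lintegral_smul_measure, lintegral_smul_measure,
      lintegral_map' hmeas.aemeasurable (hξ.prodMk hξ),
      lintegral_map' hmeas.aemeasurable (hξ.prodMk hη)]
    simp only [edist_self, ENNReal.zero_rpow_of_pos hp, lintegral_zero, smul_zero, zero_add]
    rw [smul_eq_mul]
    refine mul_le_of_le_one_left' ?_
    rw [← hab]; exact le_add_self
  · rw [Measure.map_add _ _ measurable_fst, Measure.map_smul, Measure.map_smul,
      AEMeasurable.map_map_of_aemeasurable measurable_fst.aemeasurable (hξ.prodMk hξ),
      AEMeasurable.map_map_of_aemeasurable measurable_fst.aemeasurable (hξ.prodMk hη)]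
    change a • ρ.toMeasure.map ξ + b • ρ.toMeasure.map ξ = ρ.toMeasure.map ξ
    rw [← add_smul, hab, one_smul]
  · rw [Measure.map_add _ _ measurable_snd, Measure.map_smul, Measure.map_smul,
      AEMeasurable.map_map_of_aemeasurable measurable_snd.aemeasurable (hξ.prodMk hξ),
      AEMeasurable.map_map_of_aemeasurable measurable_snd.aemeasurable (hξ.prodMk hη)]
    rfl

theorem W_two_push_mix_le (ρ : P2 d) (ξ η : ρ.L2) (τ : unitInterval) :
    W 2 (ρ.push ξ) ((ρ.push ξ).mix (ρ.push η) τ) ≤ ‖η - ξ‖ := by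
  refine ENNReal.toReal_le_of_le_ofReal (norm_nonneg _)
    ((wassersteinE_push_mix_le ρ ξ η τ two_pos).trans (le_of_eq ?_))
  rw [ofReal_norm, Lp.enorm_def,
    eLpNorm_eq_lintegral_rpow_enorm_toReal two_ne_zero ENNReal.ofNat_ne_top]
  simp only [ENNReal.toReal_ofNat]
  congr 1
  refine lintegral_congr_ae ?_
  filter_upwards [Lp.coeFn_sub η ξ] with x hx
  rw [hx, Pi.sub_apply, edist_comm, edist_eq_enorm_sub]

theorem W_one_push_mix_le (ρ : P2 d) (ξ η : ρ.L2) (τ : unitInterval) {D : ℝ} (hD : 0 ≤ D)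
    (h : ∀ᵐ x ∂ρ.toMeasure, ‖η x - ξ x‖ ≤ D) :
    W 1 (ρ.push ξ) ((ρ.push ξ).mix (ρ.push η) τ) ≤ D := by
  refine ENNReal.toReal_le_of_le_ofReal hD
    ((wassersteinE_push_mix_le ρ ξ η τ one_pos).trans ?_)
  simp only [ENNReal.rpow_one, div_one]
  calc ∫⁻ x, edist (ξ x) (η x) ∂ρ.toMeasure
      ≤ ∫⁻ _, ENNReal.ofReal D ∂ρ.toMeasure := by
        refine lintegral_mono_ae ?_
        filter_upwards [h] with x hx
        rw [edist_comm, edist_dist, dist_eq_norm]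
        exact ENNReal.ofReal_le_ofReal hx
    _ = ENNReal.ofReal D := by simp

end P2

/-! ### Mean value theorem along mixtures -/

section MeanValue

variable {d : ℕ} {φ : P2 d → ℝ}

theorem P2.push_idL2 (ρ : P2 d) : ρ.push ρ.idL2 = ρ := by
  apply P2.ext_of_toMeasure
  exact (Measure.map_congr (MemLp.coeFn_toLp ρ.memLp)).trans Measure.map_id

theorem P2.W_two_self (ρ : P2 d) : P2.W 2 ρ ρ = 0 := by
  have h := P2.W_two_push_mix_le ρ ρ.idL2 ρ.idL2 0
  rw [P2.mix_zero, P2.push_idL2, sub_self, norm_zero] at h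
  exact le_antisymm h ENNReal.toReal_nonneg

theorem JointlyContinuous.continuous {A B : Type*} [PseudoMetricSpace A] [PseudoMetricSpace B]
    {f : P2 d → A → B} (hf : JointlyContinuous f) (ρ : P2 d) :
    Continuous (f ρ) := by
  refine Metric.continuous_iff.2 fun a ε hε => ?_
  obtain ⟨δ, hδ, h⟩ := hf ρ a ε hε
  refine ⟨δ, hδ, fun b hb => ?_⟩
  rw [dist_comm] at hb ⊢
  exact h ρ b (by rwa [ρ.W_two_self]) hb

theorem IsFirstVariation.integrable {F : P2 d → E d → ℝ} (hF : IsFirstVariation φ F)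
    (ρ μ : P2 d) : Integrable (F ρ) μ.toMeasure :=
  μ.integrable_of_quadraticGrowth (hF.cont.continuous ρ) (hF.growth ρ)

theorem IsFirstVariation.hasDerivWithinAt_mix {F : P2 d → E d → ℝ} (hF : IsFirstVariation φ F)
    (μ ν : P2 d) :
    HasDerivWithinAt (fun ε : ℝ => φ (μ.mix ν (projIcc 0 1 zero_le_one ε)))
      ((∫ x, F μ x ∂ν.toMeasure) - ∫ x, F μ x ∂μ.toMeasure) (Ioi 0) 0 := by
  rw [hasDerivWithinAt_iff_tendsto_slope' self_notMem_Ioi]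
  have hproj : Tendsto (projIcc (0 : ℝ) 1 zero_le_one) (𝓝[>] 0) (𝓝[>] 0) := by
    refine tendsto_nhdsWithin_iff.2 ⟨?_, ?_⟩
    · have := (continuous_projIcc (h := zero_le_one (α := ℝ))).tendsto 0
      rw [projIcc_left] at this
      exact this.mono_left nhdsWithin_le_nhds
    · filter_upwards [self_mem_nhdsWithin] with ε hε
      rw [mem_Ioi, ← Subtype.coe_lt_coe, coe_projIcc]
      exact lt_max_of_lt_right (lt_min one_pos hε)
  refine ((hF.limit μ ν).comp hproj).congr' ?_
  filter_upwards [Ioo_mem_nhdsGT one_pos] with ε hε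
  have h1 : ((projIcc (0 : ℝ) 1 zero_le_one ε : unitInterval) : ℝ) = ε := by
    rw [projIcc_of_mem zero_le_one (Ioo_subset_Icc_self hε)]
  have h2 : projIcc (0 : ℝ) 1 zero_le_one 0 = 0 := projIcc_left _
  simp only [Function.comp_apply, slope_def_field, h1, sub_zero, h2, P2.mix_zero]

/-- Along the segment from `μ` to `ν` a functional with a first variation is differentiable: its
one-sided derivatives are the directional derivatives towards `ν` and towards `μ`. -/
theorem IsFirstVariation.hasDerivAt_mix {F : P2 d → E d → ℝ} (hF : IsFirstVariation φ F)
    (μ ν : P2 d) {τ : ℝ} (hτ : τ ∈ Ioo (0 : ℝ) 1) :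
    HasDerivAt (fun s : ℝ => φ (μ.mix ν (projIcc 0 1 zero_le_one s)))
      ((∫ x, F (μ.mix ν (projIcc 0 1 zero_le_one τ)) x ∂ν.toMeasure)
        - ∫ x, F (μ.mix ν (projIcc 0 1 zero_le_one τ)) x ∂μ.toMeasure) τ := by
  set T : unitInterval := projIcc 0 1 zero_le_one τ with hT
  have hTτ : (T : ℝ) = τ := by
    rw [hT, projIcc_of_mem zero_le_one (Ioo_subset_Icc_self hτ)]
  set m := μ.mix ν T with hm
  have hmix := P2.integral_mix μ ν T (hF.integrable m μ) (hF.integrable m ν)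
  rw [← hm, hTτ] at hmix
  have h1τ : 0 < 1 - τ := sub_pos.2 hτ.2
  rw [← hasDerivWithinAt_univ, ← Iic_union_Ici (a := τ)]
  refine HasDerivWithinAt.union ?_ ?_
  -- To the left of `τ` the segment is run from `m` back to `μ`, at speed `1 / τ`.
  · refine HasDerivWithinAt.Iic_of_Iio ?_
    have h1 := hF.hasDerivWithinAt_mix m μ
    have h2 : HasDerivWithinAt (fun s : ℝ => (τ - s) / τ) (-1 / τ) (Iio τ) τ :=
      (((hasDerivAt_id τ).const_sub τ).div_const τ).hasDerivWithinAt
    have h3 := h1.comp_of_eq τ h2 (fun s hs => div_pos (sub_pos.2 hs) hτ.1) (by simp)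
    refine (h3.congr_deriv ?_).congr_of_eventuallyEq ?_ ?_
    · rw [hmix]; field_simp [hτ.1.ne']; ring
    · filter_upwards [Ioo_mem_nhdsLT hτ.1] with s hs
      have hs' : (τ - s) / τ ∈ Icc (0 : ℝ) 1 :=
        ⟨div_nonneg (sub_nonneg.2 hs.2.le) hτ.1.le,
          (div_le_one hτ.1).2 (by linarith [hs.1])⟩
      have hs2 : s ∈ Icc (0 : ℝ) 1 := ⟨hs.1.le, (hs.2.trans hτ.2).le⟩
      simp only [Function.comp_apply]
      rw [hm, P2.mix_mix_left μ ν]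
      rw [projIcc_of_mem zero_le_one hs', projIcc_of_mem zero_le_one hs2, hTτ]
      field_simp [hτ.1.ne']
      ring
    · simp only [Function.comp_apply, sub_self, zero_div]
      rw [projIcc_left]
      exact congrArg φ (P2.mix_zero m μ).symm
  -- To the right of `τ` it is run from `m` on to `ν`, at speed `1 / (1 - τ)`.
  · refine HasDerivWithinAt.Ici_of_Ioi ?_
    have h1 := hF.hasDerivWithinAt_mix m ν
    have h2 : HasDerivWithinAt (fun s : ℝ => (s - τ) / (1 - τ)) (1 / (1 - τ)) (Ioi τ) τ :=
      (((hasDerivAt_id τ).sub_const τ).div_const (1 - τ)).hasDerivWithinAt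
    have h3 := h1.comp_of_eq τ h2 (fun s hs => div_pos (sub_pos.2 hs) h1τ) (by simp)
    refine (h3.congr_deriv ?_).congr_of_eventuallyEq ?_ ?_
    · rw [hmix]; field_simp [h1τ.ne']; ring
    · filter_upwards [Ioo_mem_nhdsGT hτ.2] with s hs
      have hs' : (s - τ) / (1 - τ) ∈ Icc (0 : ℝ) 1 :=
        ⟨div_nonneg (sub_nonneg.2 hs.1.le) h1τ.le,
          (div_le_one h1τ).2 (by linarith [hs.2])⟩
      have hs2 : s ∈ Icc (0 : ℝ) 1 := ⟨(hτ.1.trans hs.1).le, hs.2.le⟩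
      simp only [Function.comp_apply]
      rw [hm, P2.mix_mix_right μ ν]
      rw [projIcc_of_mem zero_le_one hs', projIcc_of_mem zero_le_one hs2, hTτ]
      field_simp [h1τ.ne']
      ring
    · simp only [Function.comp_apply, sub_self, zero_div]
      rw [projIcc_left]
      exact congrArg φ (P2.mix_zero m ν).symm

theorem IsFirstVariation.integral_firstVariation_sub {F : P2 d → E d → ℝ}
    (hF : IsFirstVariation φ F) (m μ ν : P2 d) :
    (∫ x, firstVariation φ m x ∂ν.toMeasure) - ∫ x, firstVariation φ m x ∂μ.toMeasure
      = (∫ x, F m x ∂ν.toMeasure) - ∫ x, F m x ∂μ.toMeasure := by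
  simp only [firstVariation_eq hF]
  rw [integral_sub (hF.integrable m ν) (integrable_const _),
    integral_sub (hF.integrable m μ) (integrable_const _)]
  simp

theorem IsC1P2.integrable_firstVariation (hφ : IsC1P2 φ) (m μ : P2 d) :
    Integrable (firstVariation φ m) μ.toMeasure := by
  obtain ⟨F, hF⟩ := hφ
  refine ((hF.integrable m μ).sub (integrable_const (∫ y, F m y ∂m.toMeasure))).congr ?_
  exact Eventually.of_forall fun x => (firstVariation_eq hF m x).symm

/-- Lagrange's mean value theorem on the segment of measures from `μ` to `ν`. -/
theorem IsC1P2.exists_mix_mean_value (hφ : IsC1P2 φ) (μ ν : P2 d) :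
    ∃ τ : unitInterval, φ ν - φ μ = (∫ x, firstVariation φ (μ.mix ν τ) x ∂ν.toMeasure)
      - ∫ x, firstVariation φ (μ.mix ν τ) x ∂μ.toMeasure := by
  have hφ' := hφ
  obtain ⟨F, hF⟩ := hφ'
  have hcont : ContinuousOn (fun s : ℝ => φ (μ.mix ν (projIcc 0 1 zero_le_one s))) (Icc 0 1) := by
    intro s hs
    rcases eq_or_lt_of_le hs.1 with rfl | h0
    · exact (hF.hasDerivWithinAt_mix μ ν).Ici_of_Ioi.continuousWithinAt.mono Icc_subset_Ici_self
    -- At the endpoint `1` continuity comes from the reversed segment, run from `ν` to `μ`.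
    rcases eq_or_lt_of_le hs.2 with rfl | h1
    · have h2 : HasDerivWithinAt (fun s : ℝ => 1 - s) (-1) (Iio 1) 1 :=
        ((hasDerivAt_id (1 : ℝ)).const_sub 1).hasDerivWithinAt
      have h3 := (hF.hasDerivWithinAt_mix ν μ).comp_of_eq 1 h2
        (fun s hs => mem_Ioi.2 (sub_pos.2 hs)) (by simp)
      have hsymm : ∀ s ∈ Icc (0 : ℝ) 1, φ (μ.mix ν (projIcc 0 1 zero_le_one s))
          = φ (ν.mix μ (projIcc 0 1 zero_le_one (1 - s))) := by
        intro s hs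
        rw [P2.mix_comm]
        rw [projIcc_of_mem zero_le_one hs,
          projIcc_of_mem zero_le_one ⟨sub_nonneg.2 hs.2, sub_le_self 1 hs.1⟩]
        simp
      exact (h3.Iic_of_Iio.continuousWithinAt.mono Icc_subset_Iic_self).congr hsymm
        (hsymm 1 hs)
    · exact (hF.hasDerivAt_mix μ ν ⟨h0, h1⟩).continuousAt.continuousWithinAt
  obtain ⟨c, hc, hc'⟩ := exists_hasDerivAt_eq_slope _ _ one_pos hcont
    (fun s hs => hF.hasDerivAt_mix μ ν hs)
  refine ⟨projIcc 0 1 zero_le_one c, ?_⟩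
  rw [hF.integral_firstVariation_sub, hc', projIcc_left, projIcc_right, sub_zero, div_one]
  exact congrArg₂ (fun a b => φ a - φ b) (P2.mix_one μ ν).symm (P2.mix_zero μ ν).symm

/-- Mean value theorem for push-forwards: the increment of `φ` from `ξ_# ρ` to `η_# ρ` is the
Wasserstein gradient at an intermediate measure and at intermediate points, tested against
`η - ξ`. -/
theorem IsC1W.exists_push_mean_value (hφ : IsC1W φ) (ρ : P2 d) (ξ η : ρ.L2) :
    ∃ τ : unitInterval, ∃ c : E d → E d, (∀ z, c z ∈ segment ℝ (ξ z) (η z)) ∧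
      Integrable (fun z => inner ℝ (wGrad φ ((ρ.push ξ).mix (ρ.push η) τ) (c z)) (η z - ξ z))
        ρ.toMeasure ∧
      φ (ρ.push η) - φ (ρ.push ξ) =
        ∫ z, inner ℝ (wGrad φ ((ρ.push ξ).mix (ρ.push η) τ) (c z)) (η z - ξ z)
          ∂ρ.toMeasure := by
  obtain ⟨τ, hτ⟩ := hφ.isC1P2.exists_mix_mean_value (ρ.push ξ) (ρ.push η)
  set m := (ρ.push ξ).mix (ρ.push η) τ
  have hmvt : ∀ z, ∃ c ∈ segment ℝ (ξ z) (η z), firstVariation φ m (η z)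
      - firstVariation φ m (ξ z) = inner ℝ (wGrad φ m c) (η z - ξ z) := by
    intro z
    obtain ⟨c, hc, h⟩ := domain_mvt (s := univ)
      (fun x _ => ((hφ.diff m x).hasGradientAt.hasFDerivAt).hasFDerivWithinAt)
      convex_univ (mem_univ (ξ z)) (mem_univ (η z))
    exact ⟨c, hc, h⟩
  choose c hc hcz using hmvt
  have hI : ∀ θ : ρ.L2, Integrable (fun z => firstVariation φ m (θ z)) ρ.toMeasure := fun θ =>
    (hφ.isC1P2.integrable_firstVariation m (ρ.push θ)).comp_aemeasurable
      (Lp.aestronglyMeasurable θ).aemeasurable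
  have hmap : ∀ θ : ρ.L2, ∫ x, firstVariation φ m x ∂(ρ.push θ).toMeasure
      = ∫ z, firstVariation φ m (θ z) ∂ρ.toMeasure := fun θ =>
    integral_map (Lp.aestronglyMeasurable θ).aemeasurable
      (hφ.diff m).continuous.aestronglyMeasurable
  refine ⟨τ, c, hc, ?_, ?_⟩
  · exact ((hI η).sub (hI ξ)).congr (Eventually.of_forall hcz)
  · rw [← integral_congr_ae (Eventually.of_forall hcz)]
    rw [hτ, hmap, hmap, integral_sub (hI η) (hI ξ)]

end MeanValue

/-! ### The gradient of the lift -/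

section LiftGradient

variable {d : ℕ} {φ : P2 d → ℝ}

theorem IsC1W.memLp_wGrad_comp (hφ : IsC1W φ) {C : ℝ} (hC : ∀ ρ x, ‖wGrad φ ρ x‖ ≤ C) (ρ : P2 d)
    (ξ : ρ.L2) : MemLp (fun x => wGrad φ (ρ.push ξ) (ξ x)) 2 ρ.toMeasure :=
  MemLp.of_bound ((hφ.cont.continuous _).comp_aestronglyMeasurable
    (Lp.aestronglyMeasurable ξ)) C (Eventually.of_forall fun _ => hC _ _)

/-- Directional derivatives of the lift. The mean value theorem for push-forwards writes the
difference quotient as an integral of `∇_W φ` at intermediate measures and points, which converge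
to `ξ_# ρ` and `ξ`; joint continuity and dominated convergence give the limit. -/
theorem IsC1W.tendsto_liftL2_slope (hφ : IsC1W φ) {C : ℝ} (hC : ∀ ρ x, ‖wGrad φ ρ x‖ ≤ C)
    (ρ : P2 d) (ξ η : ρ.L2) {s : ℕ → ℝ} (hs0 : ∀ n, s n ≠ 0) (hs : Tendsto s atTop (𝓝 0)) :
    Tendsto (fun n => (s n)⁻¹ • (liftL2 φ ρ (ξ + s n • η) - liftL2 φ ρ ξ)) atTop
      (𝓝 (∫ x, inner ℝ (wGrad φ (ρ.push ξ) (ξ x)) (η x) ∂ρ.toMeasure)) := by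
  choose τ c hc hint heq using fun n => hφ.exists_push_mean_value ρ ξ (ξ + s n • η)
  set m := fun n => (ρ.push ξ).mix (ρ.push (ξ + s n • η)) (τ n) with hm
  have hW : Tendsto (fun n => P2.W 2 (ρ.push ξ) (m n)) atTop (𝓝 0) := by
    have h0 : Tendsto (fun n => ‖s n • η‖) atTop (𝓝 0) := by
      simpa using (hs.smul_const η).norm
    refine squeeze_zero (fun n => ENNReal.toReal_nonneg) (fun n => ?_) h0
    simpa using P2.W_two_push_mix_le ρ ξ (ξ + s n • η) (τ n)
  have hcoe : ∀ᵐ z ∂ρ.toMeasure, ∀ n, (ξ + s n • η : ρ.L2) z - ξ z = s n • η z := by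
    refine ae_all_iff.2 fun n => ?_
    filter_upwards [Lp.coeFn_add ξ (s n • η), Lp.coeFn_smul (s n) η] with z h1 h2
    rw [h1, Pi.add_apply, h2, Pi.smul_apply, add_sub_cancel_left]
  have hquot : ∀ᵐ z ∂ρ.toMeasure, ∀ n,
      (s n)⁻¹ * inner ℝ (wGrad φ (m n) (c n z)) ((ξ + s n • η : ρ.L2) z - ξ z)
        = inner ℝ (wGrad φ (m n) (c n z)) (η z) := by
    filter_upwards [hcoe] with z hz n
    rw [hz, inner_smul_right, inv_mul_cancel_left₀ (hs0 n)]
  have hdiff : ∀ n, (s n)⁻¹ • (liftL2 φ ρ (ξ + s n • η) - liftL2 φ ρ ξ)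
      = ∫ z, (s n)⁻¹ * inner ℝ (wGrad φ (m n) (c n z)) ((ξ + s n • η : ρ.L2) z - ξ z)
          ∂ρ.toMeasure := by
    intro n
    rw [integral_const_mul, smul_eq_mul]
    exact congrArg _ (heq n)
  simp only [hdiff]
  refine tendsto_integral_of_dominated_convergence (fun z => C * ‖η z‖)
    (fun n => ((hint n).const_mul _).aestronglyMeasurable)
    (((Lp.memLp η).integrable one_le_two).norm.const_mul C) (fun n => ?_) ?_
  · filter_upwards [hquot] with z hz
    rw [hz n]
    exact (norm_inner_le_norm _ _).trans (by gcongr; exact hC _ _)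
  · filter_upwards [hquot, hcoe] with z hz hz'
    simp only [hz]
    refine Tendsto.inner ?_ tendsto_const_nhds
    have hcz : Tendsto (fun n => dist (ξ z) (c n z)) atTop (𝓝 0) := by
      have h0 : Tendsto (fun n => ‖s n • η z‖) atTop (𝓝 0) := by
        simpa using (hs.smul_const (η z)).norm
      refine squeeze_zero (fun n => dist_nonneg) (fun n => ?_) h0
      rw [← hz' n, dist_comm, dist_eq_norm]
      exact norm_sub_le_of_mem_segment (hc n z)
    refine Metric.tendsto_nhds.2 fun ε hε => ?_
    obtain ⟨δ, hδ, h⟩ := hφ.cont (ρ.push ξ) (ξ z) ε hε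
    filter_upwards [hW.eventually_lt_const hδ, hcz.eventually_lt_const hδ] with n h1 h2
    rw [dist_comm]
    exact h _ _ h1 h2

/-- The gradient of the lift at `ξ` is the Wasserstein gradient at `ξ_# ρ` along `ξ`. -/
theorem IsC1W.gradient_liftL2_ae_eq (hφ : IsC1W φ) {C : ℝ} (hC : ∀ ρ x, ‖wGrad φ ρ x‖ ≤ C)
    (ρ : P2 d) (ξ : ρ.L2) (hd : DifferentiableAt ℝ (liftL2 φ ρ) ξ) :
    (gradient (liftL2 φ ρ) ξ : ρ.L2) =ᵐ[ρ.toMeasure] fun x => wGrad φ (ρ.push ξ) (ξ x) := by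
  have hG := hφ.memLp_wGrad_comp hC ρ ξ
  suffices h : gradient (liftL2 φ ρ) ξ = hG.toLp _ by
    rw [h]; exact hG.coeFn_toLp
  refine ext_inner_right ℝ fun η => ?_
  have hs : Tendsto (fun n : ℕ => 1 / ((n : ℝ) + 1)) atTop (𝓝 0) :=
    tendsto_one_div_add_atTop_nhds_zero_nat
  have hs0 : ∀ n : ℕ, 1 / ((n : ℝ) + 1) ≠ 0 := fun n => (Nat.one_div_pos_of_nat).ne'
  have h1 := hφ.tendsto_liftL2_slope hC ρ ξ η hs0 hs
  have h2 := (hd.hasGradientAt.hasFDerivAt.hasLineDerivAt η).tendsto_slope_zero.comp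
    (tendsto_nhdsWithin_iff.2 ⟨hs, Eventually.of_forall hs0⟩)
  have h3 := tendsto_nhds_unique h2 h1
  rw [InnerProductSpace.toDual_apply_apply] at h3
  rw [h3, L2.inner_def]
  refine integral_congr_ae ?_
  filter_upwards [hG.coeFn_toLp] with x hx
  rw [hx]

end LiftGradient

/-! ### First order expansion of the Wasserstein gradient along push-forwards -/

section Expansion

variable {d : ℕ} {φ : P2 d → ℝ}

/-- The regularity of `φ` used for the acceleration: `φ ∈ C²(W₂)` whose Wasserstein
gradient is bounded and whose second derivatives are bounded and `α`-Hölder, all with the same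
constant `C`. -/
structure HasHolderHessian (φ : P2 d → ℝ) (α C : ℝ≥0) : Prop where
  isC2W : IsC2W φ
  diff : ∀ ρ, Differentiable ℝ (wGrad φ ρ)
  grad_le : ∀ ρ x, ‖wGrad φ ρ x‖ ≤ C
  fderiv_le : ∀ ρ x, ‖fderiv ℝ (wGrad φ ρ) x‖ ≤ C
  hess_le : ∀ ρ x y, ‖wHess φ ρ x y‖ ≤ C
  fderiv_holder : ∀ ρ, HolderWith C α (fderiv ℝ (wGrad φ ρ))
  hess_holder : ∀ ρ, HolderWith C α (fun p : E d × E d => wHess φ ρ p.1 p.2)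
  hess_measure : ∀ μ ν x y, ‖wHess φ μ x y - wHess φ ν x y‖ ≤ C * P2.W 1 μ ν ^ (α : ℝ)

/-- The derivative of the lifted gradient at `ξ` in direction `w`, evaluated at `x`: a local term
from moving the point and a nonlocal term from moving the measure. The direction is a map rather
than an element of `L²`, so that sums of representatives can be inserted directly. -/
noncomputable def hessAction (φ : P2 d → ℝ) (ρ : P2 d) (ξ : ρ.L2) (w : E d → E d) (x : E d) : E d :=
  fderiv ℝ (wGrad φ (ρ.push ξ)) (ξ x) (w x)
    + ∫ z, wHess φ (ρ.push ξ) (ξ x) (ξ z) (w z) ∂ρ.toMeasure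

theorem wHess_apply (φ : P2 d → ℝ) (ρ : P2 d) (x y v : E d) (i : Fin d) :
    wHess φ ρ x y v i = inner ℝ (wGrad (fun μ => wGrad φ μ x i) ρ y) v := by
  simp [wHess]

theorem EuclideanSpace.norm_le_card_mul {v : E d} {M : ℝ} (h : ∀ i, |v i| ≤ M) :
    ‖v‖ ≤ d * M := by
  rcases Nat.eq_zero_or_pos d with rfl | hd
  · simp [Subsingleton.elim v 0]
  have hM : 0 ≤ M := (abs_nonneg _).trans (h ⟨0, hd⟩)
  have hd1 : (1 : ℝ) ≤ d := by exact_mod_cast hd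
  rw [EuclideanSpace.norm_eq]
  refine Real.sqrt_le_iff.2 ⟨by positivity, ?_⟩
  calc ∑ i, ‖v i‖ ^ 2 ≤ ∑ _i : Fin d, M ^ 2 := by
        gcongr with i; exact h i
    _ = d * M ^ 2 := by simp
    _ ≤ (d * M) ^ 2 := by rw [mul_pow]; gcongr; nlinarith

namespace HasHolderHessian

variable {α C : ℝ≥0}

theorem continuous_wHess (hφ : HasHolderHessian φ α C) (ρ : P2 d) :
    Continuous fun p : E d × E d => wHess φ ρ p.1 p.2 :=
  hφ.isC2W.cont.continuous ρ

theorem integrable_wHess (hφ : HasHolderHessian φ α C) (ρ : P2 d) (μ : P2 d) (ξ : ρ.L2) (x : E d)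
    {w : E d → E d} (hw : Integrable w ρ.toMeasure) :
    Integrable (fun z => wHess φ μ x (ξ z) (w z)) ρ.toMeasure := by
  refine Integrable.mono' (hw.norm.const_mul C) ?_ (Eventually.of_forall fun z =>
    (ContinuousLinearMap.le_opNorm _ _).trans (by gcongr; exact hφ.hess_le _ _ _))
  have h1 : AEStronglyMeasurable (fun z => wHess φ μ x (ξ z)) ρ.toMeasure :=
    ((hφ.continuous_wHess μ).comp (by fun_prop : Continuous fun y : E d => (x, y)))
      |>.comp_aestronglyMeasurable (Lp.aestronglyMeasurable ξ)
  exact (ContinuousLinearMap.apply ℝ (E d)).flip.aestronglyMeasurable_comp₂ h1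
    hw.aestronglyMeasurable

theorem norm_hessAction_le (hφ : HasHolderHessian φ α C) (ρ : P2 d) (ξ : ρ.L2) {w : E d → E d}
    {B : ℝ} (hw : ∀ᵐ z ∂ρ.toMeasure, ‖w z‖ ≤ B) :
    ∀ᵐ x ∂ρ.toMeasure, ‖hessAction φ ρ ξ w x‖ ≤ 2 * C * B := by
  filter_upwards [hw] with x hx
  have h1 : ‖fderiv ℝ (wGrad φ (ρ.push ξ)) (ξ x) (w x)‖ ≤ C * B :=
    (ContinuousLinearMap.le_opNorm _ _).trans (by gcongr; exact hφ.fderiv_le _ _)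
  have h2 : ‖∫ z, wHess φ (ρ.push ξ) (ξ x) (ξ z) (w z) ∂ρ.toMeasure‖ ≤ C * B := by
    refine (norm_integral_le_of_norm_le_const (C := C * B) ?_).trans (by simp)
    filter_upwards [hw] with z hz
    exact (ContinuousLinearMap.le_opNorm _ _).trans (by gcongr; exact hφ.hess_le _ _ _)
  exact (norm_add_le _ _).trans (by linarith)

theorem hessAction_sub_smul (hφ : HasHolderHessian φ α C) (ρ : P2 d) (ξ : ρ.L2)
    {w w' : E d → E d} (hw : Integrable w ρ.toMeasure) (hw' : Integrable w' ρ.toMeasure) (h : ℝ)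
    (x : E d) : hessAction φ ρ ξ (fun z => w z - h • w' z) x
      = hessAction φ ρ ξ w x - h • hessAction φ ρ ξ w' x := by
  simp only [hessAction, map_sub, map_smul]
  rw [integral_sub (hφ.integrable_wHess ρ _ ξ _ hw)
    ((hφ.integrable_wHess ρ _ ξ _ hw').fun_smul h), integral_smul, smul_add]
  abel

theorem memLp_hessAction (hφ : HasHolderHessian φ α C) (hα : 0 < α) (ρ : P2 d) (ξ : ρ.L2)
    {w : E d → E d} (hwm : AEStronglyMeasurable w ρ.toMeasure) {B : ℝ}
    (hw : ∀ᵐ z ∂ρ.toMeasure, ‖w z‖ ≤ B) : MemLp (hessAction φ ρ ξ w) 2 ρ.toMeasure := by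
  have hξ := Lp.aestronglyMeasurable ξ
  have hint : Integrable w ρ.toMeasure := (MemLp.of_bound hwm B hw).integrable le_rfl
  refine MemLp.of_bound (AEStronglyMeasurable.add ?_ ?_) _ (hφ.norm_hessAction_le ρ ξ hw)
  · exact (ContinuousLinearMap.apply ℝ (E d)).flip.aestronglyMeasurable_comp₂
      (((hφ.fderiv_holder _).continuous hα).comp_aestronglyMeasurable hξ) hwm
  · have hcont : Continuous fun y : E d =>
        ∫ z, wHess φ (ρ.push ξ) y (ξ z) (w z) ∂ρ.toMeasure := by
      refine continuous_of_dominated (bound := fun z => C * ‖w z‖)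
        (fun y => (hφ.integrable_wHess ρ _ ξ y hint).aestronglyMeasurable)
        (fun y => Eventually.of_forall fun z => (ContinuousLinearMap.le_opNorm _ _).trans
          (by gcongr; exact hφ.hess_le _ _ _)) (hint.norm.const_mul _)
        (Eventually.of_forall fun z => ?_)
      exact ((hφ.continuous_wHess _).comp
        (by fun_prop : Continuous fun y : E d => (y, ξ z))).clm_apply continuous_const
    exact hcont.comp_aestronglyMeasurable hξ

/-- Coordinatewise mean value theorem for `∇_W φ(·, y)` along push-forwards. -/
theorem exists_wGrad_push_mean_value (hφ : HasHolderHessian φ α C) (ρ : P2 d) (ξ η : ρ.L2)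
    (y : E d) (i : Fin d) :
    ∃ τ : unitInterval, ∃ c : E d → E d, (∀ z, c z ∈ segment ℝ (ξ z) (η z)) ∧
      Integrable (fun z => wHess φ ((ρ.push ξ).mix (ρ.push η) τ) y (c z) (η z - ξ z) i)
        ρ.toMeasure ∧
      wGrad φ (ρ.push η) y i - wGrad φ (ρ.push ξ) y i =
        ∫ z, wHess φ ((ρ.push ξ).mix (ρ.push η) τ) y (c z) (η z - ξ z) i ∂ρ.toMeasure := by
  simpa only [← wHess_apply] using (hφ.isC2W.grad_isC1W y i).exists_push_mean_value ρ ξ η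

theorem norm_wGrad_push_sub_le (hφ : HasHolderHessian φ α C) (ρ : P2 d) (ξ η : ρ.L2) {D : ℝ}
    (hD : ∀ᵐ z ∂ρ.toMeasure, ‖η z - ξ z‖ ≤ D) (y : E d) :
    ‖wGrad φ (ρ.push η) y - wGrad φ (ρ.push ξ) y‖ ≤ d * (C * D) := by
  refine EuclideanSpace.norm_le_card_mul fun i => ?_
  obtain ⟨τ, c, -, -, h⟩ := hφ.exists_wGrad_push_mean_value ρ ξ η y i
  rw [PiLp.sub_apply, h, ← Real.norm_eq_abs]
  refine (norm_integral_le_of_norm_le_const (C := C * D) ?_).trans (by simp)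
  filter_upwards [hD] with z hz
  exact (PiLp.norm_apply_le _ i).trans ((ContinuousLinearMap.le_opNorm _ _).trans
    (by gcongr; exact hφ.hess_le _ _ _))

/-- Dependence of `∇_W φ` on the measure, to first order. The nonlocal term is evaluated at a point
`x` close to `y`, which costs no more than the Hölder error. -/
theorem norm_wGrad_push_sub_sub_integral_le (hφ : HasHolderHessian φ α C) (ρ : P2 d)
    (ξ η : ρ.L2) {D : ℝ} (hD0 : 0 ≤ D) (hD : ∀ᵐ z ∂ρ.toMeasure, ‖η z - ξ z‖ ≤ D) {x y : E d}
    (hxy : ‖y - x‖ ≤ D) :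
    ‖wGrad φ (ρ.push η) y - wGrad φ (ρ.push ξ) y
        - ∫ z, wHess φ (ρ.push ξ) x (ξ z) (η z - ξ z) ∂ρ.toMeasure‖
      ≤ d * (2 * C * D ^ (α : ℝ) * D) := by
  refine EuclideanSpace.norm_le_card_mul fun i => ?_
  obtain ⟨τ, c, hc, hint, h⟩ := hφ.exists_wGrad_push_mean_value ρ ξ η y i
  have hδ : Integrable (fun z => η z - ξ z) ρ.toMeasure :=
    ((Lp.memLp η).integrable one_le_two).sub ((Lp.memLp ξ).integrable one_le_two)
  have hint' := hφ.integrable_wHess ρ (ρ.push ξ) ξ x hδ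
  have hproj : (∫ z, wHess φ (ρ.push ξ) x (ξ z) (η z - ξ z) ∂ρ.toMeasure) i
      = ∫ z, wHess φ (ρ.push ξ) x (ξ z) (η z - ξ z) i ∂ρ.toMeasure :=
    ((EuclideanSpace.proj i : E d →L[ℝ] ℝ).integral_comp_comm hint').symm
  have hinti : Integrable (fun z => wHess φ (ρ.push ξ) x (ξ z) (η z - ξ z) i) ρ.toMeasure :=
    (EuclideanSpace.proj i : E d →L[ℝ] ℝ).integrable_comp hint'
  rw [PiLp.sub_apply, PiLp.sub_apply, h, hproj, ← integral_sub hint hinti, ← Real.norm_eq_abs]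
  refine (norm_integral_le_of_norm_le_const (C := 2 * C * D ^ (α : ℝ) * D) ?_).trans (by simp)
  have hW := P2.W_one_push_mix_le ρ ξ η τ hD0 hD
  filter_upwards [hD] with z hz
  set m := (ρ.push ξ).mix (ρ.push η) τ
  have h1 : ‖wHess φ m y (c z) - wHess φ (ρ.push ξ) y (c z)‖ ≤ C * D ^ (α : ℝ) := by
    rw [norm_sub_rev]
    refine (hφ.hess_measure _ _ _ _).trans ?_
    gcongr
    exact ENNReal.toReal_nonneg
  have hdist : dist (y, c z) (x, ξ z) ≤ D := by
    rw [Prod.dist_eq, dist_eq_norm, dist_eq_norm]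
    exact max_le hxy ((norm_sub_le_of_mem_segment (hc z)).trans hz)
  have h2 : ‖wHess φ (ρ.push ξ) y (c z) - wHess φ (ρ.push ξ) x (ξ z)‖ ≤ C * D ^ (α : ℝ) := by
    have h := (hφ.hess_holder (ρ.push ξ)).dist_le_of_le hdist
    rwa [dist_eq_norm] at h
  have h3 : ‖wHess φ m y (c z) - wHess φ (ρ.push ξ) x (ξ z)‖ ≤ 2 * C * D ^ (α : ℝ) := by
    refine (norm_sub_le_norm_sub_add_norm_sub _ (wHess φ (ρ.push ξ) y (c z)) _).trans ?_
    linarith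
  rw [← PiLp.sub_apply, ← sub_apply]
  exact (PiLp.norm_apply_le _ i).trans ((ContinuousLinearMap.le_opNorm _ _).trans (by gcongr))

/-- Dependence of `∇_W φ` on the point, to first order. -/
theorem norm_wGrad_sub_sub_fderiv_le (hφ : HasHolderHessian φ α C) (μ : P2 d) {x y : E d} {D : ℝ}
    (hxy : ‖y - x‖ ≤ D) :
    ‖wGrad φ μ y - wGrad φ μ x - fderiv ℝ (wGrad φ μ) x (y - x)‖ ≤ C * D ^ (α : ℝ) * D := by
  have hD0 : 0 ≤ D := (norm_nonneg _).trans hxy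
  refine ((convex_segment x y).norm_image_sub_le_of_norm_hasFDerivWithin_le'
    (f' := fderiv ℝ (wGrad φ μ)) (C := C * D ^ (α : ℝ))
    (fun z _ => (hφ.diff μ z).hasFDerivAt.hasFDerivWithinAt) (fun z hz => ?_)
    (left_mem_segment ℝ x y) (right_mem_segment ℝ x y)).trans (by gcongr)
  rw [← dist_eq_norm]
  refine (hφ.fderiv_holder μ).dist_le_of_le ?_
  rw [dist_eq_norm]
  exact (norm_sub_le_of_mem_segment hz).trans hxy

theorem norm_wGrad_push_comp_sub_le (hφ : HasHolderHessian φ α C) (ρ : P2 d) (ξ η : ρ.L2) {D : ℝ}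
    (hD : ∀ᵐ z ∂ρ.toMeasure, ‖η z - ξ z‖ ≤ D) :
    ∀ᵐ x ∂ρ.toMeasure, ‖wGrad φ (ρ.push η) (η x) - wGrad φ (ρ.push ξ) (ξ x)‖
      ≤ (d + 1) * C * D := by
  filter_upwards [hD] with x hx
  have h1 := hφ.norm_wGrad_push_sub_le ρ ξ η hD (η x)
  have h2 : ‖wGrad φ (ρ.push ξ) (η x) - wGrad φ (ρ.push ξ) (ξ x)‖ ≤ C * D :=
    (convex_univ.norm_image_sub_le_of_norm_fderiv_le (𝕜 := ℝ)
      (fun z _ => hφ.diff (ρ.push ξ) z) (fun z _ => hφ.fderiv_le (ρ.push ξ) z)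
      (mem_univ _) (mem_univ _)).trans (by gcongr)
  refine (norm_sub_le_norm_sub_add_norm_sub _ (wGrad φ (ρ.push ξ) (η x)) _).trans ?_
  linarith

/-- The lifted gradient has `hessAction` as its derivative along essentially bounded displacements,
with an error of order `1 + α`. -/
theorem norm_wGrad_push_comp_sub_sub_hessAction_le (hφ : HasHolderHessian φ α C) (ρ : P2 d)
    (ξ η : ρ.L2) {D : ℝ} (hD0 : 0 ≤ D) (hD : ∀ᵐ z ∂ρ.toMeasure, ‖η z - ξ z‖ ≤ D) :
    ∀ᵐ x ∂ρ.toMeasure, ‖wGrad φ (ρ.push η) (η x) - wGrad φ (ρ.push ξ) (ξ x)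
        - hessAction φ ρ ξ (fun z => η z - ξ z) x‖ ≤ (2 * d + 1) * C * (D ^ (α : ℝ) * D) := by
  filter_upwards [hD] with x hx
  have h1 := hφ.norm_wGrad_push_sub_sub_integral_le ρ ξ η hD0 hD hx
  have h2 := hφ.norm_wGrad_sub_sub_fderiv_le (ρ.push ξ) hx
  refine le_trans (le_of_eq ?_) ((norm_add_le _ _).trans ((add_le_add h1 h2).trans
    (le_of_eq (by ring))))
  rw [hessAction]
  congr 1
  abel

end HasHolderHessian
end Expansion

/-! ### The acceleration of the Lagrangian flow -/

theorem lp_norm_le_of_ae_norm_le {Ω F : Type*} [MeasurableSpace Ω] {μ : Measure Ω}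
    [IsProbabilityMeasure μ] [NormedAddCommGroup F] {f : Lp F 2 μ} {M : ℝ} (hM : 0 ≤ M)
    (h : ∀ᵐ x ∂μ, ‖f x‖ ≤ M) : ‖f‖ ≤ M := by
  simpa [measureUnivNNReal] using Lp.norm_le_of_ae_bound hM h

section Flow

variable {d : ℕ} {φ : P2 d → ℝ} {α C : ℝ≥0}

/-- Along a curve with velocity `-∇_W φ(X_# ρ, X)`, positions and velocities are Lipschitz in time
uniformly in the particle, so the position has a second order expansion in the essential norm. -/
theorem HasHolderHessian.ae_norm_position_sub_le (hφ : HasHolderHessian φ α C) (ρ : P2 d)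
    {X V : ℝ → ρ.L2} (hX : ∀ t, HasDerivAt X (V t) t) (hVc : Continuous V)
    (hV : ∀ t, V t =ᵐ[ρ.toMeasure] fun x => -wGrad φ (ρ.push (X t)) (X t x)) (t h : ℝ) :
    (∀ᵐ x ∂ρ.toMeasure, ‖X (t + h) x - X t x‖ ≤ C * |h|) ∧
      ∀ᵐ x ∂ρ.toMeasure, ‖X (t + h) x - X t x - h • V t x‖
        ≤ (d + 1) * C * (C * |h|) * |h| := by
  have hVb : ∀ t, ∀ᵐ x ∂ρ.toMeasure, ‖V t x‖ ≤ C := by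
    intro t
    filter_upwards [hV t] with x hx
    rw [hx, norm_neg]
    exact hφ.grad_le _ _
  have hXl : ∀ s t, ∀ᵐ x ∂ρ.toMeasure, ‖X s x - X t x‖ ≤ C * |s - t| := fun s t =>
    ae_norm_sub_le_of_hasDerivAt hX hVc fun r _ => hVb r
  have hVl : ∀ s t, ∀ᵐ x ∂ρ.toMeasure, ‖V s x - V t x‖ ≤ (d + 1) * C * (C * |s - t|) := by
    intro s t
    filter_upwards [hV s, hV t, hφ.norm_wGrad_push_comp_sub_le ρ (X t) (X s) (hXl s t)]
      with x h1 h2 h3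
    rw [h1, h2, neg_sub_neg, norm_sub_rev]
    exact h3
  refine ⟨by simpa using hXl (t + h) t, ?_⟩
  -- The increments of `s ↦ X s - s • V t`, whose velocity `V s - V t` is small near `t`.
  have hY : ∀ s, HasDerivAt (fun s => X s - s • V t) (V s - V t) s := fun s => by
    simpa using (hX s).fun_sub ((hasDerivAt_id s).smul_const (V t))
  have hYb : ∀ s ∈ uIcc t (t + h), ∀ᵐ x ∂ρ.toMeasure,
      ‖(V s - V t) x‖ ≤ (d + 1) * C * (C * |h|) := by
    intro s hs
    have hs' : |s - t| ≤ |h| := by simpa using abs_sub_left_of_mem_uIcc hs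
    filter_upwards [hVl s t, Lp.coeFn_sub (V s) (V t)] with x h1 h2
    rw [h2, Pi.sub_apply]
    exact h1.trans (by gcongr)
  filter_upwards [ae_norm_sub_le_of_hasDerivAt hY (hVc.sub continuous_const) hYb,
    Lp.coeFn_sub (X (t + h)) ((t + h) • V t), Lp.coeFn_sub (X t) (t • V t),
    Lp.coeFn_smul (t + h) (V t), Lp.coeFn_smul t (V t)] with x h1 h2 h3 h4 h5
  rw [h2, h3, Pi.sub_apply, Pi.sub_apply, h4, h5, Pi.smul_apply, Pi.smul_apply,
    add_sub_cancel_left] at h1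
  have hsplit : X (t + h) x - X t x - h • V t x
      = X (t + h) x - (t + h) • V t x - (X t x - t • V t x) := by
    rw [add_smul]
    abel
  rwa [hsplit]

/-- The velocity `V = -∇_W φ(X_# ρ, X)` of a curve `X` is `C^{1,α}` with acceleration
`-hessAction`. -/
theorem HasHolderHessian.exists_acceleration (hφ : HasHolderHessian φ α C) (hα0 : 0 < α)
    (hα1 : α ≤ 1) (ρ : P2 d) {X V : ℝ → ρ.L2} (hX : ∀ t, HasDerivAt X (V t) t)
    (hVc : Continuous V)
    (hV : ∀ t, V t =ᵐ[ρ.toMeasure] fun x => -wGrad φ (ρ.push (X t)) (X t x)) :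
    ∃ A : ℝ → ρ.L2, (∀ t, A t =ᵐ[ρ.toMeasure] fun x => -hessAction φ ρ (X t) (V t) x) ∧
      ∃ K : ℝ, ∀ t h, ‖V (t + h) - V t - h • A t‖ ≤ K * |h| ^ (1 + (α : ℝ)) := by
  have hVb : ∀ t, ∀ᵐ x ∂ρ.toMeasure, ‖V t x‖ ≤ C := by
    intro t
    filter_upwards [hV t] with x hx
    rw [hx, norm_neg]
    exact hφ.grad_le _ _
  have hint : ∀ f : ρ.L2, Integrable f ρ.toMeasure := fun f => (Lp.memLp f).integrable one_le_two
  have hmem := fun t => (hφ.memLp_hessAction hα0 ρ (X t)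
    (Lp.aestronglyMeasurable (V t)) (hVb t)).neg
  have hA : ∀ t, (hmem t).toLp _ =ᵐ[ρ.toMeasure] fun x => -hessAction φ ρ (X t) (V t) x :=
    fun t => (hmem t).coeFn_toLp
  refine ⟨fun t => (hmem t).toLp _, hA, (2 * d + 1) * C * ((C : ℝ) ^ (α : ℝ) * C)
    + 2 * C * ((d + 1) * C * C) + (2 * C + 2 * C * C), fun t h => ?_⟩
  refine lp_norm_le_of_ae_norm_le (by positivity) ?_
  obtain ⟨hX1, hX2⟩ := hφ.ae_norm_position_sub_le ρ hX hVc hV t h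
  have hcoe : ∀ᵐ x ∂ρ.toMeasure, (V (t + h) - V t - h • (hmem t).toLp _ : ρ.L2) x
      = V (t + h) x - V t x + h • hessAction φ ρ (X t) (V t) x := by
    filter_upwards [Lp.coeFn_sub (V (t + h) - V t) (h • (hmem t).toLp _),
      Lp.coeFn_sub (V (t + h)) (V t), Lp.coeFn_smul h ((hmem t).toLp _), hA t] with x h1 h2 h3 h4
    rw [h1, Pi.sub_apply, h2, Pi.sub_apply, h3, Pi.smul_apply, h4, smul_neg, sub_neg_eq_add]
  rcases le_total |h| 1 with hh | hh
  · have hsq : |h| * |h| ≤ |h| ^ (1 + (α : ℝ)) := by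
      rw [Real.rpow_add' (abs_nonneg h) (by positivity), Real.rpow_one]
      gcongr
      exact Real.self_le_rpow_of_le_one (abs_nonneg h) hh (by exact_mod_cast hα1)
    have hpow : (C * |h|) ^ (α : ℝ) * (C * |h|)
        = (C : ℝ) ^ (α : ℝ) * C * |h| ^ (1 + (α : ℝ)) := by
      rw [Real.rpow_add' (abs_nonneg h) (by positivity), Real.rpow_one,
        Real.mul_rpow C.coe_nonneg (abs_nonneg h)]
      ring
    filter_upwards [hcoe, hV t, hV (t + h),
      hφ.norm_wGrad_push_comp_sub_sub_hessAction_le ρ (X t) (X (t + h)) (by positivity) hX1,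
      hφ.norm_hessAction_le ρ (X t) hX2] with x h1 h2 h3 h4 h5
    rw [hφ.hessAction_sub_smul ρ (X t) (w := fun z => X (t + h) z - X t z)
      ((hint _).sub (hint _)) (hint _)] at h5
    have hsplit : V (t + h) x - V t x + h • hessAction φ ρ (X t) (V t) x
        = -((wGrad φ (ρ.push (X (t + h))) (X (t + h) x) - wGrad φ (ρ.push (X t)) (X t x)
            - hessAction φ ρ (X t) (fun z => X (t + h) z - X t z) x)
          + (hessAction φ ρ (X t) (fun z => X (t + h) z - X t z) x
            - h • hessAction φ ρ (X t) (V t) x)) := by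
      rw [h2, h3]; abel
    rw [h1, hsplit, norm_neg]
    refine (norm_add_le _ _).trans ((add_le_add h4 h5).trans ?_)
    rw [hpow]
    have e1 : 2 * (C : ℝ) * ((d + 1) * C * (C * |h|) * |h|)
        ≤ 2 * C * ((d + 1) * C * C) * |h| ^ (1 + (α : ℝ)) := by
      calc 2 * (C : ℝ) * ((d + 1) * C * (C * |h|) * |h|)
          = 2 * C * ((d + 1) * C * C) * (|h| * |h|) := by ring
        _ ≤ _ := by gcongr
    have e2 : 0 ≤ (2 * (C : ℝ) + 2 * C * C) * |h| ^ (1 + (α : ℝ)) := by positivity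
    linarith
  -- For `|h| ≥ 1` the expansion is no better than the trivial bound, which is of first order in `h`.
  · have hpow : |h| ≤ |h| ^ (1 + (α : ℝ)) :=
      Real.self_le_rpow_of_one_le hh (by simp)
    filter_upwards [hcoe, hVb t, hVb (t + h), hφ.norm_hessAction_le ρ (X t) (hVb t)]
      with x h1 h2 h3 h4
    rw [h1]
    calc ‖V (t + h) x - V t x + h • hessAction φ ρ (X t) (V t) x‖
        ≤ ‖V (t + h) x‖ + ‖V t x‖ + |h| * ‖hessAction φ ρ (X t) (V t) x‖ := by
          refine (norm_add_le _ _).trans (add_le_add (norm_sub_le _ _) ?_)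
          rw [norm_smul, Real.norm_eq_abs]
      _ ≤ C + C + |h| * (2 * C * C) := by gcongr
      _ ≤ (2 * C + 2 * C * C) * |h| := by
          nlinarith [mul_nonneg C.coe_nonneg (sub_nonneg.2 hh)]
      _ ≤ (2 * C + 2 * C * C) * |h| ^ (1 + (α : ℝ)) := by gcongr
      _ ≤ _ :=
          mul_le_mul_of_nonneg_right (le_add_of_nonneg_left (by positivity)) (by positivity)

end Flow

theorem theorem4p5 {d : ℕ} (φ : P2 d → ℝ) (ρ₀ : P2 d) (hatoms : ∀ x : E d, ρ₀.toMeasure {x} = 0)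
    (hlift : IsC1HolderFunctional 1 (liftL2 φ ρ₀))
    (hC2 : IsC2W φ) (hgrowth : LocallyUniformGrowth φ)
    (hdiff : ∀ ρ, Differentiable ℝ (wGrad φ ρ))
    (α C : ℝ≥0) (hα0 : 0 < α) (hα1 : α ≤ 1)
    (hbound : ∀ ρ x y,
      ‖wGrad φ ρ x‖ + ‖fderiv ℝ (wGrad φ ρ) x‖ + ‖wHess φ ρ x y‖ ≤ C)
    (hgradHolder : ∀ ρ, HolderWith C α (fderiv ℝ (wGrad φ ρ)))
    (hhessHolder : ∀ ρ, HolderWith C α (fun p : E d × E d => wHess φ ρ p.1 p.2))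
    (hhessMeasure : ∀ μ ν x y,
      ‖wHess φ μ x y - wHess φ ν x y‖ ≤ C * P2.W 1 μ ν ^ (α : ℝ)) :
    ∃ X : ℝ → ρ₀.L2,
      IsLagrangianFlow φ ρ₀ X ∧
      (∀ Y : ℝ → ρ₀.L2, IsLagrangianFlow φ ρ₀ Y → EqOn Y X (Ici 0)) ∧
      IsC1HolderCurve α (timeDeriv X) ∧
      ∀ t : ℝ, 0 ≤ t → ∀ᵐ x ∂ρ₀.toMeasure,
        Integrable (fun z => wHess φ (ρ₀.push (X t)) (X t x) (X t z) (timeDeriv X t z))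
          ρ₀.toMeasure ∧
        timeDeriv (timeDeriv X) t x =
          -(fderiv ℝ (wGrad φ (ρ₀.push (X t))) (X t x) (timeDeriv X t x)
            + ∫ z, wHess φ (ρ₀.push (X t)) (X t x) (X t z) (timeDeriv X t z)
                ∂ρ₀.toMeasure) := by
  have hφ : HasHolderHessian φ α C :=
    { isC2W := hC2
      diff := hdiff
      grad_le := fun ρ x => by
        linarith [hbound ρ x x, norm_nonneg (fderiv ℝ (wGrad φ ρ) x), norm_nonneg (wHess φ ρ x x)]
      fderiv_le := fun ρ x => by
        linarith [hbound ρ x x, norm_nonneg (wGrad φ ρ x), norm_nonneg (wHess φ ρ x x)]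
      hess_le := fun ρ x y => by
        linarith [hbound ρ x y, norm_nonneg (wGrad φ ρ x),
          norm_nonneg (fderiv ℝ (wGrad φ ρ) x)]
      fderiv_holder := hgradHolder
      hess_holder := hhessHolder
      hess_measure := hhessMeasure }
  obtain ⟨hdl, K, hK⟩ := hlift
  have hgrad := fun ξ : ρ₀.L2 => hC2.isC1W.gradient_liftL2_ae_eq hφ.grad_le ρ₀ ξ (hdl ξ)
  have hlip : LipschitzWith K fun ξ : ρ₀.L2 => -gradient (liftL2 φ ρ₀) ξ :=
    (holderWith_one.1 hK).neg
  have hb : ∀ ξ : ρ₀.L2, ‖-gradient (liftL2 φ ρ₀) ξ‖ ≤ C := by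
    intro ξ
    rw [norm_neg]
    refine lp_norm_le_of_ae_norm_le C.coe_nonneg ?_
    filter_upwards [hgrad ξ] with x hx
    rw [hx]
    exact hφ.grad_le _ _
  obtain ⟨X, hX0, hX⟩ := exists_integralCurve_of_lipschitzWith_of_norm_le hlip hb ρ₀.idL2
  set V : ℝ → ρ₀.L2 := fun t => -gradient (liftL2 φ ρ₀) (X t) with hVdef
  have hXc : Continuous X := continuous_iff_continuousAt.2 fun t => (hX t).continuousAt
  have hV : ∀ t, V t =ᵐ[ρ₀.toMeasure] fun x => -wGrad φ (ρ₀.push (X t)) (X t x) := by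
    intro t
    filter_upwards [hgrad (X t), Lp.coeFn_neg (gradient (liftL2 φ ρ₀) (X t))] with x h1 h2
    rw [h2, Pi.neg_apply, h1]
  obtain ⟨A, hA, M, hM⟩ := hφ.exists_acceleration hα0 hα1 ρ₀ hX (hlip.continuous.comp hXc) hV
  have hVA : ∀ t, HasDerivAt V (A t) t := fun t =>
    hasDerivAt_of_norm_sub_le_rpow (NNReal.coe_pos.2 hα0) (hM t)
  have hud : UniqueDiffOn ℝ (Ici (0 : ℝ)) := uniqueDiffOn_Ici 0
  have hvel : ∀ t : ℝ, 0 ≤ t → timeDeriv X t = V t := fun t ht =>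
    (hX t).hasDerivWithinAt.derivWithin (hud t ht)
  have hvelA : ∀ t : ℝ, 0 ≤ t → HasDerivWithinAt (timeDeriv X) (A t) (Ici 0) t := fun t ht =>
    (hVA t).hasDerivWithinAt.congr (fun s hs => hvel s hs) (hvel t ht)
  have hacc : ∀ t : ℝ, 0 ≤ t → timeDeriv (timeDeriv X) t = A t := fun t ht =>
    (hvelA t ht).derivWithin (hud t ht)
  refine ⟨X, ⟨hX0, fun t _ => (hX t).hasDerivWithinAt⟩, ?_, ⟨?_, M, ?_⟩, ?_⟩
  · rintro Y ⟨hY0, hY⟩ t ht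
    refine ODE_solution_unique (v := fun _ ξ => -gradient (liftL2 φ ρ₀) ξ) (K := K) (a := 0)
      (b := t) (fun _ => hlip) (fun s hs => (hY s hs.1).continuousWithinAt.mono Icc_subset_Ici_self)
      (fun s hs => (hY s hs.1).mono (Ici_subset_Ici.2 hs.1)) hXc.continuousOn
      (fun s _ => (hX s).hasDerivWithinAt) (hY0.trans hX0.symm) ⟨ht, le_rfl⟩
  · exact fun t ht => (hvelA t ht).differentiableWithinAt
  · intro t h ht hth
    rw [hvel _ hth, hvel t ht, hacc t ht]
    exact hM t h
  · intro t ht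
    rw [hacc t ht, hvel t ht]
    filter_upwards [hA t] with x hx
    exact ⟨hφ.integrable_wHess ρ₀ _ (X t) _ ((Lp.memLp (V t)).integrable one_le_two), hx⟩
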